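/- Let $p$ be a prime, let $r \ge p$ be an integer, and let $r_0 \in \{0,\dots,p-1\}$ be the residue of $r$ modulo $p$, i.e. the constant digit of the base-$p$ expansion of $r$. Let $V_r$ be the space of homogeneous polynomials of degree $r$ in $X, Y$ over $\mathbb{F}_p$, with $\Gamma = \mathrm{GL}_2(\mathbb{F}_p)$ acting by $$\begin{pmatrix} a & b \\ c & d \end{pmatrix}\cdot F(X,Y) = F(aX+cY,\, bX+dY).$$ For $0 \le i \le r$ let $X_{r-i} \subseteq V_r$ be the $\Gamma$-submodule generated by the monomial $X^{r-i}Y^i$, and let the carry pattern of $i$ be the sequence of carries ($0$s and $1$s) that occur when $i$ and $r-i$ are added digit by digit in base $p$. For an integer $n \ge 0$ let $\Sigma_p(n)$ be the sum of the base-$p$ digits of $n$. Let $0 \le j < i \le p-1$. Then $X_{r-j} = X_{r-i}$ if and only if $$r_0 \notin \{j, j+1, \dots, i-1\}, \qquad \Sigma_p(r-j) \le p-1 \qquad\text{and}\qquad \Sigma_p(r-r_0) \le j.$$ Likewise, $X_{r-j} = X_{r-i}$ if and only if $i$ and $j$ have the same carry pattern, $\Sigma_p(r-j) \le p-1$ and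 $\Sigma_p(r-r_0) \le j$. -/

import Mathlib

namespace MonomialLattice

open MvPolynomial

/-- The substitution `F(X, Y) ↦ F(aX + cY, bX + dY)` attached to the matrix `!![a, b; c, d]`,
where `X = X 0` and `Y = X 1`. -/
noncomputable def subst {k : Type*} [CommRing k] (g : Matrix (Fin 2) (Fin 2) k) :
    MvPolynomial (Fin 2) k →ₐ[k] MvPolynomial (Fin 2) k :=
  aeval ![C (g 0 0) * X 0 + C (g 1 0) * X 1, C (g 0 1) * X 0 + C (g 1 1) * X 1]

theorem subst_one {k : Type*} [CommRing k] :
    subst (1 : Matrix (Fin 2) (Fin 2) k) = AlgHom.id k _ := by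
  apply MvPolynomial.algHom_ext
  intro i
  fin_cases i <;> simp [subst]

theorem subst_mul {k : Type*} [CommRing k] (g h : Matrix (Fin 2) (Fin 2) k) :
    subst (g * h) = (subst g).comp (subst h) := by
  apply MvPolynomial.algHom_ext
  intro i
  fin_cases i <;> simp [subst, Matrix.mul_apply, Fin.sum_univ_two, algHom_C] <;> ring

theorem subst_mem {k : Type*} [CommRing k] (g : Matrix (Fin 2) (Fin 2) k) (r : ℕ)
    (F : MvPolynomial (Fin 2) k) (hF : F ∈ homogeneousSubmodule (Fin 2) k r) :
    subst g F ∈ homogeneousSubmodule (Fin 2) k r := by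
  rw [mem_homogeneousSubmodule] at hF ⊢
  have key : ∀ a b : k, (C a * X 0 + C b * X 1 : MvPolynomial (Fin 2) k).IsHomogeneous 1 :=
    fun a b => (isHomogeneous_C_mul_X a 0).add (isHomogeneous_C_mul_X b 1)
  have h : ∀ i : Fin 2, ((![C (g 0 0) * X 0 + C (g 1 0) * X 1,
      C (g 0 1) * X 0 + C (g 1 1) * X 1] : Fin 2 → MvPolynomial (Fin 2) k) i).IsHomogeneous 1 := by
    intro i
    fin_cases i
    · exact key (g 0 0) (g 1 0)
    · exact key (g 0 1) (g 1 1)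
  have h2 := hF.aeval _ h
  rw [one_mul] at h2
  exact h2

/-- The `r`-th symmetric power representation `V_r` of `GL₂(k)`: homogeneous polynomials of
degree `r` in `X, Y` over `k`, a matrix with rows `(a, b)`, `(c, d)` sending
`F(X, Y)` to `F(aX + cY, bX + dY)`. -/
noncomputable def symPow (k : Type*) [CommRing k] (r : ℕ) :
    Representation k (GL (Fin 2) k) (homogeneousSubmodule (Fin 2) k r) where
  toFun g := (subst (g : Matrix (Fin 2) (Fin 2) k)).toLinearMap.restrict (subst_mem _ r)
  map_one' := by
    ext1 F
    apply Subtype.ext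
    simp [LinearMap.restrict_apply, subst_one]
  map_mul' g h := by
    ext1 F
    apply Subtype.ext
    simp only [Units.val_mul, subst_mul]
    rfl

/-- The monomial `X ^ (r - i) * Y ^ i`, `0 ≤ i ≤ r`, as an element of `V_r`. -/
noncomputable def monomialVec (k : Type*) [CommRing k] (r : ℕ) (i : Fin (r + 1)) :
    homogeneousSubmodule (Fin 2) k r :=
  ⟨X 0 ^ (r - (i : ℕ)) * X 1 ^ (i : ℕ), by
    have h := ((isHomogeneous_X k (0 : Fin 2)).pow (r - (i : ℕ))).mul
      ((isHomogeneous_X k (1 : Fin 2)).pow (i : ℕ))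
    rw [mem_homogeneousSubmodule]
    convert h using 1
    omega⟩

/-- The subrepresentation generated by a vector `v`: the linear span of its orbit. -/
def generatedBy {k G V : Type*} [CommRing k] [Group G] [AddCommGroup V] [Module k V]
    (ρ : Representation k G V) (v : V) : Subrepresentation ρ where
  toSubmodule := Submodule.span k (Set.range fun g : G => ρ g v)
  apply_mem_toSubmodule g w hw := by
    induction hw using Submodule.span_induction with
    | mem x hx =>
      obtain ⟨h, rfl⟩ := hx
      exact Submodule.subset_span ⟨g * h, by simp⟩
    | zero => simp
    | add x y _ _ hx hy => rw [map_add]; exact Submodule.add_mem _ hx hy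
    | smul c x _ hx => rw [map_smul]; exact Submodule.smul_mem _ c hx

/-- The monomial submodule `X_{r-i}` of `V_r` over `𝔽_p`: the `GL₂(𝔽_p)`-submodule generated by
`X ^ (r - i) * Y ^ i`. -/
noncomputable def monomialSubmodule (p r : ℕ) [Fact p.Prime] (i : Fin (r + 1)) :
    Subrepresentation (symPow (ZMod p) r) :=
  generatedBy (symPow (ZMod p) r) (monomialVec (ZMod p) r i)

/-- `Σ_p(n)`: the sum of the base-`p` digits of `n`. -/
def digitSum (p n : ℕ) : ℕ := (Nat.digits p n).sum

/-- The carry into position `t` (the position of `p ^ t`) when `a` and `b` are added digit by digit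
in base `p`; there is no carry into position `0`. -/
def carry (p a b : ℕ) : ℕ → ℕ
  | 0 => 0
  | t + 1 => if p ≤ a / p ^ t % p + b / p ^ t % p + carry p a b t then 1 else 0

/-- The carry pattern of `i` (with respect to `r`): the sequence of carries in the base-`p`
addition `i + (r - i) = r`. -/
def carryPattern (p r : ℕ) (i : Fin (r + 1)) : ℕ → ℕ := carry p i (r - (i : ℕ))

end MonomialLattice

/-!
Setting `X = 1` identifies `V_r` with the polynomials of degree at most `r` in one variable `y`
over `𝔽_p`, and `X_{r-j}` with `orbitSpan p n j`, `n = r - j`, the span of the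
`(a + c y) ^ n (b + d y) ^ j` with `a d - b c ≠ 0`. For `j < p` it contains all `(1 + c y) ^ n f`
with `deg f ≤ j` (`pow_mul_X_pow_mem_orbitSpan`). Hence `X_{r-j} ⊆ X_{r-i}` for `j < i < p`, and
equality means `y ^ i ∈ orbitSpan p n j`. With `a = n % p`, `N = n / p` and `A = Σ_p(N)`, this is
shown to hold if and only if `i ≤ a + j`, `a + A ≤ p - 1` and `A ≤ j`; the conditions of the
theorem are a rewriting of these three (`digit_conditions_iff`, `carryPattern_eq_iff`).

Both directions rest on a sparsity bound (`lt_card_support_of_dvd`): a nonzero polynomial of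
degree `< p` divisible by `(1 + y) ^ a` has more than `a` nonzero coefficients. Put
`D = min (p - 1) (a + j)`, so that the last two conditions together say `A ≤ D - a`.

*Necessity.* If `y ^ i` lies in the span, there is `g` of degree at most `j` such that `y ^ i` and
`(1 + y) ^ n g` agree at all exponents between `j` and `n` congruent to `i` modulo `p - 1`. Write
`(1 + y) ^ n g = G * (1 + y ^ p) ^ N` with `G = (1 + y) ^ a g`. The exponent `i` gives `G_i = 1`,
so `i ≤ a + j`. If `A > D - a`, then each `s` with `1 ≤ s ≤ D - a + 1` is the digit sum of some
`M` with `N.choose M ≠ 0` in `𝔽_p`, and the exponent `i - s + p M` gives `G_{i - s} = 0`. The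
remainder of `G` modulo `1 + y ^ p = (1 + y) ^ p` is then divisible by `(1 + y) ^ a`, nonzero, of
degree at most `D`, and has `D - a + 1` vanishing coefficients, contrary to the sparsity bound.

*Sufficiency.* Since `c ^ p = c`, the polynomial `(1 + c y ^ p) ^ N` depends on `c` through a
polynomial `Ψ` in `c` of degree at most `A` with constant term `1`. So `(1 + c y) ^ n` is given by
`E = (1 + c y) ^ a Ψ`, of degree at most `a + A < p` in `c`, and interpolation at the elements of
`𝔽_p` puts `y ^ b E_m` in the span for `b ≤ j` and every coefficient `E_m` of `E`. By the sparsity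
bound and a dimension count there is `g` of degree at most `D - a ≤ j` such that `g * (1 + y) ^ a`
has coefficient `1` at `i` and `0` at `i - A, …, i - 1`; then the coefficient of `c ^ i` in
`g(c y) E` is `y ^ i`.
-/

open Polynomial

namespace MonomialLattice

/-! ### Interpolation and sparse multiples of powers of `1 + X` -/

/-- Interpolation: a polynomial of degree less than the cardinality of `k` whose values on `k` lie
in a `k`-subspace has its coefficients in that subspace. -/
theorem coeff_mem_of_forall_eval_mem {k R : Type*} [Field k] [CommRing R] [Algebra k R]
    (S : Submodule k R) (E : R[X]) (hE : (E.natDegree : Cardinal) < Cardinal.mk k)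
    (h : ∀ c : k, E.eval (algebraMap k R c) ∈ S) (m : ℕ) : E.coeff m ∈ S := by
  by_contra hm
  obtain ⟨f, hf, hS⟩ := Submodule.exists_le_ker_of_notMem hm
  -- A functional `f` that kills `S` turns `E` into a polynomial over `k` vanishing on all of `k`.
  set q : k[X] := ∑ t ∈ Finset.range (E.natDegree + 1), monomial t (f (E.coeff t)) with hq
  have hcoeff : ∀ t, q.coeff t = f (E.coeff t) := by
    intro t
    simp only [hq, finsetSum_coeff, coeff_monomial, Finset.sum_ite_eq', Finset.mem_range]
    split_ifs with ht
    · rfl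
    · rw [coeff_eq_zero_of_natDegree_lt (by omega), map_zero]
  have heval : ∀ c : k, q.eval c = 0 := by
    intro c
    have h1 : f (E.eval (algebraMap k R c)) = 0 := hS (h c)
    rw [eval_eq_sum_range, map_sum] at h1
    rw [hq, eval_finsetSum, ← h1]
    refine Finset.sum_congr rfl fun t _ => ?_
    rw [eval_monomial, ← map_pow, mul_comm (E.coeff t), ← Algebra.smul_def, map_smul, smul_eq_mul,
      mul_comm]
  have hdeg : q.natDegree ≤ E.natDegree :=
    natDegree_sum_le_of_forall_le _ _ fun t ht =>
      (natDegree_monomial_le _).trans (by simpa [Nat.lt_succ_iff] using ht)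
  have : q = 0 := by
    apply Polynomial.eq_zero_of_forall_eval_zero_of_natDegree_lt_card q heval
    exact lt_of_le_of_lt (by exact_mod_cast hdeg) hE
  exact hf (by rw [← hcoeff, this, coeff_zero])

/-- In characteristic `p`, a nonzero polynomial of degree `< p` divisible by `(1 + X) ^ a` has more
than `a` nonzero coefficients: if `v` is an exponent that occurs, `X d/dX - v` removes exactly the
term of exponent `v` and lowers the order of vanishing at `-1` by at most one. -/
theorem lt_card_support_of_dvd (p : ℕ) [Fact p.Prime] (a : ℕ) (G : (ZMod p)[X]) (hG : G ≠ 0)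
    (hdeg : G.natDegree < p) (hdvd : (1 + X) ^ a ∣ G) : a < G.support.card := by
  induction a generalizing G with
  | zero => simpa [Finset.card_pos, nonempty_support_iff] using hG
  | succ a ih =>
    obtain ⟨v, hv⟩ := nonempty_support_iff.mpr hG
    have hv_lt : v < p := (le_natDegree_of_mem_supp v hv).trans_lt hdeg
    set G₁ := X * derivative G - C (v : ZMod p) * G with hG₁
    have hcoeff : ∀ m, G₁.coeff m = ((m : ZMod p) - v) * G.coeff m := by
      intro m
      cases m with
      | zero => simp [hG₁]
      | succ m => simp [hG₁, coeff_X_mul, coeff_derivative]; ring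
    have hsupp : G₁.support = G.support.erase v := by
      ext m
      simp only [mem_support_iff, Finset.mem_erase, hcoeff, mul_ne_zero_iff, sub_ne_zero]
      refine and_congr_left fun hm => ?_
      have hm_lt : m < p := (le_natDegree_of_ne_zero hm).trans_lt hdeg
      rw [Ne, Ne, ZMod.natCast_eq_natCast_iff', Nat.mod_eq_of_lt hm_lt, Nat.mod_eq_of_lt hv_lt]
    have hdvd₁ : (1 + X) ^ a ∣ G₁ := by
      refine dvd_sub (Dvd.dvd.mul_left ?_ _) (Dvd.dvd.mul_left
        ((pow_dvd_pow _ (Nat.le_succ a)).trans hdvd) _)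
      simpa using pow_sub_dvd_iterate_derivative_of_pow_dvd 1 hdvd
    have hcard : G₁.support.card + 1 = G.support.card := by
      rw [hsupp, Finset.card_erase_add_one hv]
    have hG₁_ne : G₁ ≠ 0 := by
      intro h0
      obtain ⟨c, hc⟩ : ∃ c, G = C c * X ^ v := by
        rw [h0, support_zero, Finset.card_empty, zero_add] at hcard
        obtain ⟨m, c, -, h⟩ := card_support_eq_one.mp hcard.symm
        refine ⟨c, ?_⟩
        rcases eq_or_ne m v with rfl | hmv
        · exact h
        · exfalso
          apply mem_support_iff.mp hv
          simp [h, coeff_X_pow, hmv.symm]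
      have h1 : G.eval (-1) = 0 := by
        obtain ⟨Q, hQ⟩ := hdvd
        simp [hQ]
      have hc0 : c = 0 := by
        simpa [hc] using h1
      exact hG (by simp [hc, hc0])
    have hdeg₁ : G₁.natDegree < p := by
      rw [natDegree_lt_iff_degree_lt hG₁_ne, degree_lt_iff_coeff_zero]
      intro m hm
      rw [hcoeff, coeff_eq_zero_of_natDegree_lt (by omega), mul_zero]
    have := ih G₁ hG₁_ne hdeg₁ hdvd₁
    omega

/-! ### Digit sums -/

theorem digitSum_eq_mod_add_digitSum_div {p : ℕ} (hp : 1 < p) (n : ℕ) :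
    digitSum p n = n % p + digitSum p (n / p) := by
  rcases Nat.eq_zero_or_pos n with rfl | hn
  · simp [digitSum]
  · simp [digitSum, Nat.digits_def' hp hn]

theorem digitSum_zero (p : ℕ) : digitSum p 0 = 0 := by simp [digitSum]

theorem digitSum_mul_add {p : ℕ} (hp : 1 < p) (q : ℕ) {d : ℕ} (hd : d < p) :
    digitSum p (p * q + d) = d + digitSum p q := by
  rw [digitSum_eq_mod_add_digitSum_div hp, Nat.mul_add_mod, Nat.mod_eq_of_lt hd,
    Nat.mul_add_div (by omega), Nat.div_eq_of_lt hd, add_zero]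

theorem digitSum_succ_le {p : ℕ} (hp : 1 < p) (n : ℕ) :
    digitSum p (n + 1) ≤ digitSum p n + 1 := by
  induction n using Nat.strong_induction_on with
  | _ n ih =>
    have hn := Nat.div_add_mod n p
    have hlt := Nat.mod_lt n (show p > 0 by omega)
    by_cases h : n % p + 1 < p
    · have h1 : n + 1 = p * (n / p) + (n % p + 1) := by omega
      rw [h1, digitSum_mul_add hp _ h, digitSum_eq_mod_add_digitSum_div hp n]
      omega
    · have h1 : n + 1 = p * (n / p + 1) + 0 := by rw [mul_add]; omega
      rw [h1, digitSum_mul_add hp _ (by omega), digitSum_eq_mod_add_digitSum_div hp n]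
      have h2 : n / p < n := Nat.div_lt_self (by omega) hp
      have := ih _ h2
      omega

theorem pow_digitSum (p : ℕ) [Fact p.Prime] (x : ZMod p) (n : ℕ) : x ^ digitSum p n = x ^ n := by
  have hp := (Fact.out : p.Prime).one_lt
  induction n using Nat.strong_induction_on with
  | _ n ih =>
    rcases Nat.eq_zero_or_pos n with rfl | hn
    · rw [digitSum_zero]
    · rw [digitSum_eq_mod_add_digitSum_div hp, pow_add, ih _ (Nat.div_lt_self hn hp)]
      conv_rhs => rw [← Nat.div_add_mod n p, pow_add, pow_mul, ZMod.pow_card]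
      ring

theorem natCast_choose_ne_zero {p : ℕ} [Fact p.Prime] {m t : ℕ} (hm : m < p) (ht : t ≤ m) :
    ((m.choose t : ℕ) : ZMod p) ≠ 0 := by
  rw [Ne, ZMod.natCast_eq_zero_iff]
  intro hdvd
  have := hdvd.mul_right (t.factorial * (m - t).factorial)
  rw [← mul_assoc, Nat.choose_mul_factorial_mul_factorial ht,
    (Fact.out : p.Prime).dvd_factorial] at this
  omega

/-- Every `c ≤ Σ_p(N)` is the digit sum of some `M` that is digitwise at most `N`. -/
theorem exists_digitSum_eq_choose_ne_zero (p : ℕ) [Fact p.Prime] (N c : ℕ)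
    (hc : c ≤ digitSum p N) :
    ∃ M, digitSum p M = c ∧ ((N.choose M : ℕ) : ZMod p) ≠ 0 := by
  have hp := (Fact.out : p.Prime).one_lt
  induction N using Nat.strong_induction_on generalizing c with
  | _ N ih =>
    rcases Nat.eq_zero_or_pos N with rfl | hN
    · refine ⟨0, ?_, by simp⟩
      rw [digitSum_zero] at hc ⊢
      omega
    · rw [digitSum_eq_mod_add_digitSum_div hp] at hc
      obtain ⟨M, hM, hne⟩ := ih _ (Nat.div_lt_self hN hp) (min c (digitSum p (N / p)))
        (min_le_right _ _)
      have hlt := Nat.mod_lt N (show p > 0 by omega)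
      have hd : c - min c (digitSum p (N / p)) ≤ N % p := by omega
      -- The digit sum `c` is spent on the higher digits first, the rest `d` on the constant digit.
      set d := c - min c (digitSum p (N / p)) with hd_def
      refine ⟨p * M + d, ?_, ?_⟩
      · rw [digitSum_mul_add hp _ (by omega), hM]
        omega
      · have hL := Choose.choose_modEq_choose_mod_mul_choose_div_nat (p := p) (n := N)
          (k := p * M + d)
        rw [← ZMod.natCast_eq_natCast_iff] at hL
        rw [hL, Nat.mul_add_mod, Nat.mod_eq_of_lt (by omega : d < p),
          Nat.mul_add_div (by omega), Nat.div_eq_of_lt (by omega : d < p), add_zero, Nat.cast_mul]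
        refine mul_ne_zero ?_ hne
        exact natCast_choose_ne_zero hlt hd

/-! ### The dehomogenized monomial submodules -/

/-- The dehomogenization (at `X = 1`, with `Y` as the remaining variable) of the submodule generated
by `X ^ n * Y ^ j`. -/
noncomputable def orbitSpan (p n j : ℕ) : Submodule (ZMod p) (ZMod p)[X] :=
  Submodule.span (ZMod p) {F | ∃ a b c d : ZMod p, a * d - b * c ≠ 0 ∧
    F = (C a + C c * X) ^ n * (C b + C d * X) ^ j}

theorem natCast_lt_cardinalMk_zmod (p : ℕ) [Fact p.Prime] {m : ℕ} (hm : m < p) :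
    (m : Cardinal) < Cardinal.mk (ZMod p) := by
  rw [Cardinal.mk_fintype, ZMod.card]
  exact_mod_cast hm

theorem pow_add_mul_pow_sub_mem_orbitSpan {p : ℕ} [Fact p.Prime] {n j : ℕ} (hj : j < p)
    (c : ZMod p) {t : ℕ} (ht : t ≤ j) :
    (1 + C c * X) ^ (n + t) * X ^ (j - t) ∈ orbitSpan p n j := by
  set u : (ZMod p)[X] := 1 + C c * X with hu
  -- `E` is the orbit element `(1 + c X) ^ n * (b + (1 + b c) X) ^ j` as a polynomial in `b`.
  let E : (ZMod p)[X][X] := ∑ t ∈ Finset.range (j + 1),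
    monomial t ((j.choose t : ZMod p) • (u ^ (n + t) * X ^ (j - t)))
  have hdeg : E.natDegree ≤ j := natDegree_sum_le_of_forall_le _ _ fun t ht =>
    (natDegree_monomial_le _).trans (by simpa [Nat.lt_succ_iff] using ht)
  have heval : ∀ b : ZMod p, E.eval (C b) = u ^ n * (C b * u + X) ^ j := by
    intro b
    simp only [E, eval_finsetSum, eval_monomial, add_pow, Finset.mul_sum, smul_eq_C_mul,
      map_natCast]
    exact Finset.sum_congr rfl fun t _ => by rw [mul_pow]; ring
  have hmem : E.coeff t ∈ orbitSpan p n j := by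
    refine coeff_mem_of_forall_eval_mem _ E
      (natCast_lt_cardinalMk_zmod p (hdeg.trans_lt hj)) (fun b => ?_) t
    rw [algebraMap_eq, heval]
    refine Submodule.subset_span ⟨1, b, c, 1 + b * c, by ring_nf; exact one_ne_zero, ?_⟩
    rw [hu, C_add, C_mul, C_1]
    ring
  have hcoeff : E.coeff t = (j.choose t : ZMod p) • (u ^ (n + t) * X ^ (j - t)) := by
    simp only [E, finsetSum_coeff, coeff_monomial, Finset.sum_ite_eq', Finset.mem_range]
    rw [if_pos (by omega)]
  rw [hcoeff] at hmem
  exact (Submodule.smul_mem_iff _ (natCast_choose_ne_zero hj ht)).mp hmem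

/-- For `j < p` the submodule generated by `X ^ n * Y ^ j` contains `ℓ ^ n * f` for all linear
forms `ℓ = X + c Y` and all forms `f` of degree `j`. -/
theorem pow_mul_X_pow_mem_orbitSpan {p : ℕ} [Fact p.Prime] {n j : ℕ} (hj : j < p)
    (c : ZMod p) {b : ℕ} (hb : b ≤ j) : (1 + C c * X) ^ n * X ^ b ∈ orbitSpan p n j := by
  suffices h : ∀ l t b, t + b + l = j → (1 + C c * X) ^ (n + t) * X ^ b ∈ orbitSpan p n j by
    simpa using h (j - b) 0 b (by omega)
  intro l
  induction l with
  | zero =>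
    intro t b h
    obtain rfl : b = j - t := by omega
    exact pow_add_mul_pow_sub_mem_orbitSpan hj c (by omega)
  | succ l ih =>
    intro t b h
    have h1 : (1 + C c * X) ^ (n + t) * X ^ b = (1 + C c * X) ^ (n + (t + 1)) * X ^ b -
        c • ((1 + C c * X) ^ (n + t) * X ^ (b + 1)) := by
      rw [smul_eq_C_mul]
      ring
    rw [h1]
    exact sub_mem (ih _ _ (by omega)) (Submodule.smul_mem _ _ (ih _ _ (by omega)))

/-! ### Powers of `1 + c X` as polynomials in `c` -/

theorem one_add_C_mul_X_pow_eq (p : ℕ) [Fact p.Prime] (c : ZMod p) (n : ℕ) :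
    (1 + C c * X) ^ n = (1 + C c * X) ^ (n % p) * expand (ZMod p) p ((1 + C c * X) ^ (n / p)) := by
  rw [ZMod.expand_card, ← pow_mul, ← pow_add, mul_comm (n / p), Nat.mod_add_div]

theorem eval_C_map_expand {R : Type*} [CommSemiring R] (p : ℕ) (Ψ : R[X][X]) (c : R) :
    (Ψ.map (expand R p).toRingHom).eval (C c) = expand R p (Ψ.eval (C c)) := by
  rw [eval_map]
  conv_lhs => rw [← expand_C (R := R) p c]
  exact eval₂_hom (expand R p).toRingHom (C c)

theorem natDegree_one_add_C_X_mul_X_pow_le (R : Type*) [CommSemiring R] (a : ℕ) :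
    ((1 + C X * X) ^ a : R[X][X]).natDegree ≤ a := by
  have h := natDegree_linear_le (a := (X : R[X])) (b := 1)
  rw [C_1, add_comm] at h
  simpa using natDegree_pow_le_of_le a h

/-- As `c ^ p = c`, the power `(1 + c X) ^ N` is a polynomial in `c` of degree at most the digit sum
of `N`: it is the product of the `(1 + c X ^ (p ^ t)) ^ (N_t)` over the digits `N_t` of `N`. -/
theorem exists_polynomial_eval_eq_one_add_pow (p : ℕ) [Fact p.Prime] (N : ℕ) :
    ∃ Ψ : (ZMod p)[X][X], Ψ.natDegree ≤ digitSum p N ∧ Ψ.coeff 0 = 1 ∧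
      ∀ c : ZMod p, Ψ.eval (C c) = (1 + C c * X) ^ N := by
  have hp := (Fact.out : p.Prime).one_lt
  induction N using Nat.strong_induction_on with
  | _ N ih =>
    rcases Nat.eq_zero_or_pos N with rfl | hN
    · exact ⟨1, by simp, by simp, by simp⟩
    · obtain ⟨Ψ, hdeg, h0, heval⟩ := ih _ (Nat.div_lt_self hN hp)
      refine ⟨(1 + C X * X) ^ (N % p) * Ψ.map (expand (ZMod p) p).toRingHom, ?_, ?_, ?_⟩
      · rw [digitSum_eq_mod_add_digitSum_div hp]
        exact natDegree_mul_le.trans (Nat.add_le_add (natDegree_one_add_C_X_mul_X_pow_le _ _)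
          (natDegree_map_le.trans hdeg))
      · rw [mul_coeff_zero, coeff_map, h0]
        simp [coeff_zero_eq_eval_zero]
      · intro c
        rw [eval_mul, eval_C_map_expand, heval, one_add_C_mul_X_pow_eq p c N]
        simp [mul_comm X]

/-! ### Necessity of the digit conditions -/

/-- On the exponents strictly between `j` and `n` that lie in one class (`m ~ i` when
`x ^ m = x ^ i` for all `x` in `𝔽_p`), every element of the span agrees with a multiple of `(1 + X) ^ n`. -/
theorem exists_coeff_eq_of_mem_orbitSpan {p : ℕ} [Fact p.Prime] {n j : ℕ} {F : (ZMod p)[X]}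
    (hF : F ∈ orbitSpan p n j) (i : ℕ) :
    ∃ g : (ZMod p)[X], g.natDegree ≤ j ∧ ∀ m, j < m → m < n → (∀ x : ZMod p, x ^ m = x ^ i) →
      F.coeff m = ((1 + X) ^ n * g).coeff m := by
  induction hF using Submodule.span_induction with
  | zero => exact ⟨0, by simp, by simp⟩
  | add F₁ F₂ _ _ h₁ h₂ =>
    obtain ⟨g₁, hd₁, hg₁⟩ := h₁
    obtain ⟨g₂, hd₂, hg₂⟩ := h₂
    refine ⟨g₁ + g₂, natDegree_add_le_of_degree_le hd₁ hd₂, fun m h h' hx => ?_⟩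
    rw [coeff_add, hg₁ m h h' hx, hg₂ m h h' hx, mul_add, coeff_add]
  | smul r F _ h =>
    obtain ⟨g, hd, hg⟩ := h
    refine ⟨r • g, (natDegree_smul_le r g).trans hd, fun m h h' hx => ?_⟩
    rw [coeff_smul, hg m h h' hx, mul_smul_comm, coeff_smul]
  | mem F h =>
    obtain ⟨a, b, c, d, -, rfl⟩ := h
    have hfdeg : ((C b + C d * X) ^ j : (ZMod p)[X]).natDegree ≤ j := by
      have h1 := natDegree_linear_le (a := d) (b := b)
      rw [add_comm] at h1
      simpa using natDegree_pow_le_of_le j h1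
    generalize ((C b + C d * X) ^ j : (ZMod p)[X]) = f at hfdeg
    by_cases ha : a = 0
    · refine ⟨0, by simp, fun m _ hm _ => ?_⟩
      rw [ha, C_0, zero_add, mul_pow, ← C_pow, mul_assoc, coeff_C_mul, coeff_X_pow_mul',
        if_neg (by omega), mul_zero, mul_zero, coeff_zero]
    by_cases hc : c = 0
    · refine ⟨0, by simp, fun m hm _ _ => ?_⟩
      rw [hc, C_0, zero_mul, add_zero, ← C_pow, coeff_C_mul,
        coeff_eq_zero_of_natDegree_lt (by omega), mul_zero, mul_zero, coeff_zero]
    -- Now the element is `a ^ n * (1 + t X) ^ n * f`, and `t ^ m = t ^ i` turns the substitution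
    -- `X ↦ t X` into multiplication by a constant on the exponents in question.
    set t := a⁻¹ * c with ht
    have ht0 : t ≠ 0 := mul_ne_zero (inv_ne_zero ha) hc
    refine ⟨C (a ^ n * t ^ i) * f.comp (C t⁻¹ * X), ?_, fun m _ _ hx => ?_⟩
    · refine (natDegree_C_mul_le _ _).trans ?_
      rw [natDegree_comp, natDegree_C_mul_X _ (inv_ne_zero ht0), mul_one]
      exact hfdeg
    · have h1 : (C a + C c * X) ^ n * f =
          C (a ^ n) * ((1 + X) ^ n * f.comp (C t⁻¹ * X)).comp (C t * X) := by
        have h2 : (C a + C c * X : (ZMod p)[X]) = C a * (1 + C t * X) := by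
          rw [mul_add, mul_one, ← mul_assoc, ← C_mul, ht, mul_inv_cancel_left₀ ha]
        have h3 : (f.comp (C t⁻¹ * X)).comp (C t * X) = f := by
          rw [comp_assoc, mul_comp, C_comp, X_comp, ← mul_assoc, ← C_mul, inv_mul_cancel₀ ht0,
            C_1, one_mul, comp_X]
        rw [mul_comp, h3, h2]
        simp [mul_pow, mul_assoc]
      rw [h1, coeff_C_mul, comp_C_mul_X_coeff, hx t, ← mul_assoc ((1 + X) ^ n),
        mul_comm ((1 + X : (ZMod p)[X]) ^ n) (C _), mul_assoc (C _), coeff_C_mul]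
      ring

theorem coeff_mul_expand_of_coeff_eq_zero {R : Type*} [CommSemiring R] {p : ℕ}
    (G H : R[X]) {s : ℕ} (hs : s < p) (hG : ∀ q, 0 < q → G.coeff (s + p * q) = 0) (M : ℕ) :
    (G * expand R p H).coeff (s + p * M) = G.coeff s * H.coeff M := by
  rw [coeff_mul, Finset.sum_eq_single (s, p * M)]
  · rw [mul_comm p M, coeff_expand_mul (by omega)]
  · rintro ⟨x, y⟩ hxy hne
    rw [Finset.HasAntidiagonal.mem_antidiagonal] at hxy
    simp only at hxy ⊢
    by_cases hy : p ∣ y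
    · obtain ⟨M', rfl⟩ := hy
      have hM : M' ≤ M := by
        by_contra hlt
        have : p * (M + 1) ≤ p * M' := Nat.mul_le_mul_left p (by omega)
        rw [mul_add] at this
        omega
      obtain ⟨q, rfl⟩ := Nat.exists_eq_add_of_le hM
      have hx : x = s + p * q := by rw [mul_add] at hxy; omega
      have hq : 0 < q := by
        rcases Nat.eq_zero_or_pos q with rfl | hq
        · exact absurd (by simp [hx]) hne
        · exact hq
      rw [hx, hG q hq, zero_mul]
    · rw [coeff_expand (by omega), if_neg hy, mul_zero]
  · intro h
    exact absurd (Finset.HasAntidiagonal.mem_antidiagonal.mpr (by simp)) h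

/-- Reduction modulo `(1 + X) ^ p = 1 + X ^ p` of a polynomial of degree `< 2p` preserves
divisibility by `(1 + X) ^ a`, `a ≤ p`. -/
theorem one_add_X_pow_dvd_sum {p : ℕ} [Fact p.Prime] {a : ℕ} (ha : a ≤ p) {G : (ZMod p)[X]}
    (hG : G.natDegree < p + p) (hdvd : (1 + X) ^ a ∣ G) :
    (1 + X) ^ a ∣ ∑ m ∈ Finset.range p, monomial m (G.coeff m - G.coeff (m + p)) := by
  have h1 : ∑ m ∈ Finset.range p, monomial m (G.coeff m - G.coeff (m + p)) =
      G - (1 + X) ^ p * ∑ m ∈ Finset.range p, monomial m (G.coeff (m + p)) := by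
    have h2 := G.as_sum_range' _ hG
    rw [Finset.sum_range_add] at h2
    rw [add_pow_char, one_pow, add_mul, one_mul, Finset.mul_sum]
    simp only [map_sub, Finset.sum_sub_distrib, X_pow_mul_monomial]
    simp only [add_comm p] at h2
    linear_combination -h2
  rw [h1]
  exact dvd_sub hdvd (Dvd.dvd.mul_right (pow_dvd_pow _ ha) _)

/-- The hypothesis `i < n` ensures that the exponent `i` lies in the range where
`exists_coeff_eq_of_mem_orbitSpan` applies. -/
theorem digit_conditions_of_X_pow_mem_orbitSpan {p : ℕ} [Fact p.Prime] {n i j : ℕ}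
    (hji : j < i) (hip : i < p) (hin : i < n) (h : (X ^ i : (ZMod p)[X]) ∈ orbitSpan p n j) :
    i ≤ n % p + j ∧ n % p + digitSum p (n / p) ≤ p - 1 ∧ digitSum p (n / p) ≤ j := by
  obtain ⟨g, hgdeg, hg⟩ := exists_coeff_eq_of_mem_orbitSpan h i
  have hn := Nat.mod_add_div n p
  have ha : n % p < p := Nat.mod_lt _ (by omega)
  have hpow := one_add_C_mul_X_pow_eq p 1 n
  rw [C_1, one_mul] at hpow
  have hpow_digit := fun x => pow_digitSum p x
  set a := n % p
  set N := n / p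
  set G : (ZMod p)[X] := (1 + X) ^ a * g with hG
  have hGdeg : G.natDegree ≤ a + j := by
    refine natDegree_mul_le.trans (Nat.add_le_add ?_ hgdeg)
    have h1 := natDegree_linear_le (a := (1 : ZMod p)) (b := 1)
    rw [add_comm, C_1, one_mul] at h1
    simpa using natDegree_pow_le_of_le a h1
  have hGzero : ∀ m, a + j < m → G.coeff m = 0 := fun m hm =>
    coeff_eq_zero_of_natDegree_lt (by omega)
  have hcoeff : ∀ s M, s < p → a + j < s + p → j < s + p * M → s + p * M < n →
      (∀ x : ZMod p, x ^ (s + p * M) = x ^ i) →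
      (X ^ i : (ZMod p)[X]).coeff (s + p * M) = G.coeff s * N.choose M := by
    intro s M hs hsp h1 h2 hx
    rw [hg _ h1 h2 hx, hpow, mul_right_comm, ← hG,
      coeff_mul_expand_of_coeff_eq_zero _ _ hs, coeff_one_add_X_pow]
    intro q hq
    have := Nat.le_mul_of_pos_right p hq
    exact hGzero _ (by omega)
  have hGi : G.coeff i = 1 := by
    simpa [eq_comm] using hcoeff i 0 hip (by omega) (by omega) (by omega) (by simp)
  have hi : i ≤ a + j := by
    by_contra hlt
    rw [hGzero i (by omega)] at hGi
    exact zero_ne_one hGi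
  suffices hA : digitSum p N ≤ min (p - 1) (a + j) - a by omega
  by_contra hA
  set D := min (p - 1) (a + j) with hD
  -- A digitwise minorant of `N` with digit sum `s` isolates the coefficient of `G` at `i - s`.
  have hGs : ∀ s ∈ Finset.Icc 1 (D - a + 1), G.coeff (i - s) = 0 := by
    intro s hs
    rw [Finset.mem_Icc] at hs
    obtain ⟨M, hMs, hM⟩ := exists_digitSum_eq_choose_ne_zero p N s (by omega)
    have hM0 : 0 < M := by
      rcases Nat.eq_zero_or_pos M with rfl | h0
      · rw [digitSum_zero] at hMs; omega
      · exact h0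
    have hMN : M ≤ N := by
      by_contra hlt
      exact hM (by rw [Nat.choose_eq_zero_of_lt (by omega), Nat.cast_zero])
    have hpM := Nat.le_mul_of_pos_right p hM0
    have hlt : i - s + p * M < n := by
      rcases hMN.eq_or_lt with rfl | hlt
      · omega
      · have : p * (M + 1) ≤ p * N := Nat.mul_le_mul_left p hlt
        rw [mul_add] at this
        omega
    have h0 := hcoeff (i - s) M (by omega) (by omega) (by omega) hlt (fun x => by
      rw [pow_add, pow_mul, ZMod.pow_card, ← hpow_digit x M, hMs, ← pow_add,
        Nat.sub_add_cancel (by omega)])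
    rw [coeff_X_pow, if_neg (by omega)] at h0
    exact (mul_eq_zero.mp h0.symm).resolve_right hM
  -- The remainder of `G` modulo `1 + X ^ p`.
  set R := ∑ m ∈ Finset.range p, monomial m (G.coeff m - G.coeff (m + p)) with hR
  have hRcoeff : ∀ m, R.coeff m = if m < p then G.coeff m - G.coeff (m + p) else 0 := by
    intro m
    simp only [hR, finsetSum_coeff, coeff_monomial, Finset.sum_ite_eq', Finset.mem_range]
  have hR0 : R ≠ 0 := by
    intro h0
    have h1 := hRcoeff i
    rw [h0, if_pos hip, hGi, hGzero (i + p) (by omega), coeff_zero, sub_zero] at h1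
    exact zero_ne_one h1
  have hRsupp : R.support ⊆
      Finset.range (D + 1) \ (Finset.Icc 1 (D - a + 1)).image (fun s => i - s) := by
    intro m hm
    rw [mem_support_iff, hRcoeff] at hm
    have hmp : m < p := by
      by_contra hmp
      exact hm (if_neg hmp)
    rw [if_pos hmp] at hm
    rw [Finset.mem_sdiff, Finset.mem_range, Finset.mem_image]
    constructor
    · by_contra hlt
      exact hm (by rw [hGzero m (by omega), hGzero (m + p) (by omega), sub_zero])
    · rintro ⟨s, hs, rfl⟩
      have hs' := Finset.mem_Icc.mp hs
      exact hm (by rw [hGs s hs, hGzero (i - s + p) (by omega), sub_zero])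
  have hRdeg : R.natDegree < p := by
    rw [natDegree_lt_iff_degree_lt hR0, degree_lt_iff_coeff_zero]
    intro m hm
    rw [hRcoeff, if_neg (by omega)]
  have h1 := lt_card_support_of_dvd p a R hR0 hRdeg
    (one_add_X_pow_dvd_sum ha.le (by omega) (dvd_mul_right _ _))
  have h2 := Finset.card_le_card hRsupp
  rw [Finset.card_sdiff_of_subset, Finset.card_image_of_injOn, Finset.card_range,
    Nat.card_Icc] at h2
  · omega
  · intro s hs t ht hst
    simp only [Finset.coe_Icc, Set.mem_Icc] at hs ht hst
    omega
  · intro m hm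
    obtain ⟨s, hs, rfl⟩ := Finset.mem_image.mp hm
    rw [Finset.mem_Icc] at hs
    rw [Finset.mem_range]
    omega

/-! ### Sufficiency of the digit conditions -/

/-- A multiple of `(1 + X) ^ a` of degree at most `D < p` can be prescribed arbitrarily at up to
`D - a + 1` exponents; here the prescribed values are those of a Kronecker delta. -/
theorem exists_coeff_mul_one_add_pow_eq_ite {p : ℕ} [Fact p.Prime] {a D : ℕ} (haD : a ≤ D)
    (hD : D < p) (E : Finset ℕ) (hE : E ⊆ Finset.range (D + 1)) (hcard : E.card ≤ D - a + 1)
    (i : ℕ) :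
    ∃ g : (ZMod p)[X], g.natDegree ≤ D - a ∧
      ∀ m ∈ E, (g * (1 + X) ^ a).coeff m = if m = i then 1 else 0 := by
  obtain ⟨E', hEE', hE', hcard'⟩ := Finset.exists_subsuperset_card_eq hE hcard
    (by rw [Finset.card_range]; omega)
  -- The coefficients of `g * (1 + X) ^ a` at `D - a + 1` exponents, as a linear map in `g`; by
  -- `lt_card_support_of_dvd` it is injective, hence surjective.
  let T : degreeLT (ZMod p) (D - a + 1) →ₗ[ZMod p] (E' → ZMod p) :=
    LinearMap.pi fun m => (lcoeff (ZMod p) (m : ℕ)) ∘ₗ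
      (LinearMap.mulRight (ZMod p) ((1 + X : (ZMod p)[X]) ^ a)) ∘ₗ
      (degreeLT (ZMod p) (D - a + 1)).subtype
  have hT : ∀ g m, T g m = ((g : (ZMod p)[X]) * (1 + X) ^ a).coeff m := fun g m => rfl
  have hmonic : (1 + X : (ZMod p)[X]) = X + C 1 := by rw [C_1, add_comm]
  have hdeg : ∀ g : (ZMod p)[X], g ∈ degreeLT (ZMod p) (D - a + 1) → g.natDegree ≤ D - a := by
    intro g hg
    rw [mem_degreeLT] at hg
    rw [natDegree_le_iff_degree_le, Polynomial.degree_le_iff_coeff_zero]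
    intro m hm
    exact (degree_lt_iff_coeff_zero _ _).mp hg m (by exact_mod_cast hm)
  have hinj : Function.Injective T := by
    rw [← LinearMap.ker_eq_bot, LinearMap.ker_eq_bot']
    rintro ⟨g, hg⟩ h
    by_contra hne
    have hg0 : g ≠ 0 := fun h0 => hne (Subtype.ext h0)
    have hmon : ((1 + X : (ZMod p)[X]) ^ a).Monic := by
      rw [hmonic]; exact (monic_X_add_C 1).pow a
    have hGdeg : (g * (1 + X) ^ a).natDegree ≤ D := by
      refine natDegree_mul_le.trans ?_
      have := hdeg g hg
      have h2 : ((1 + X : (ZMod p)[X]) ^ a).natDegree = a := by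
        rw [hmonic, (monic_X_add_C 1).natDegree_pow, natDegree_X_add_C, mul_one]
      omega
    have hlt := lt_card_support_of_dvd p a (g * (1 + X) ^ a)
      (mul_ne_zero hg0 hmon.ne_zero) (by omega) (dvd_mul_left _ _)
    have hsub : (g * (1 + X) ^ a).support ⊆ Finset.range (D + 1) \ E' := by
      intro m hm
      rw [Finset.mem_sdiff, Finset.mem_range]
      refine ⟨by have := le_natDegree_of_mem_supp m hm; omega, fun hmE => ?_⟩
      exact mem_support_iff.mp hm ((hT ⟨g, hg⟩ ⟨m, hmE⟩).symm.trans (congrFun h ⟨m, hmE⟩))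
    have := Finset.card_le_card hsub
    rw [Finset.card_sdiff_of_subset hE', Finset.card_range] at this
    omega
  have hfin : Module.finrank (ZMod p) (degreeLT (ZMod p) (D - a + 1)) =
      Module.finrank (ZMod p) (E' → ZMod p) := by
    rw [(degreeLTEquiv (ZMod p) (D - a + 1)).finrank_eq]
    simp [hcard']
  have : FiniteDimensional (ZMod p) (degreeLT (ZMod p) (D - a + 1)) :=
    (degreeLTEquiv (ZMod p) (D - a + 1)).symm.finiteDimensional
  obtain ⟨g, hg⟩ := (LinearMap.injective_iff_surjective_of_finrank_eq_finrank hfin).mp hinj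
    (fun m => if (m : ℕ) = i then 1 else 0)
  exact ⟨g, hdeg g g.2, fun m hm => by rw [← hT g ⟨m, hEE' hm⟩, hg]⟩

/-- If `(1 + c X) ^ n` is a polynomial in `c` of degree `< p`, its coefficients, multiplied by
`X ^ b` with `b ≤ j`, lie in the dehomogenization of the submodule generated by `X ^ n * Y ^ j`. -/
theorem coeff_mul_X_pow_mem_orbitSpan {p : ℕ} [Fact p.Prime] {n j : ℕ} (hj : j < p)
    (E : (ZMod p)[X][X]) (hdeg : E.natDegree < p)
    (heval : ∀ c : ZMod p, E.eval (C c) = (1 + C c * X) ^ n) (m : ℕ) {b : ℕ} (hb : b ≤ j) :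
    E.coeff m * X ^ b ∈ orbitSpan p n j := by
  have hdeg' : (E * C (X ^ b)).natDegree < p := (natDegree_mul_C_le _ _).trans_lt hdeg
  have h : (E * C (X ^ b)).coeff m ∈ orbitSpan p n j := by
    refine coeff_mem_of_forall_eval_mem _ (E * C (X ^ b)) (natCast_lt_cardinalMk_zmod p hdeg')
      (fun c => ?_) m
    rw [algebraMap_eq, eval_mul, eval_C, heval]
    exact pow_mul_X_pow_mem_orbitSpan hj c hb
  rwa [coeff_mul_C] at h

/-- With `R[X][X]` read as the polynomials in `c` over `R[X]`, the product is
`g(c X) (1 + c X) ^ a Ψ`. Its coefficient of `c ^ i` involves only the coefficients of `g * (1 + X) ^ a` at `i - A, …, i`. -/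
theorem coeff_mul_eq_X_pow {R : Type*} [CommRing R] {a A i : ℕ} {g : R[X]} {Ψ : R[X][X]}
    (hg : ∀ m ∈ Finset.Icc (i - A) i, (g * (1 + X) ^ a).coeff m = if m = i then 1 else 0)
    (hdeg : Ψ.natDegree ≤ A) (h0 : Ψ.coeff 0 = 1) :
    ((g.map C).comp (C X * X) * ((1 + C X * X) ^ a * Ψ)).coeff i = X ^ i := by
  have hprod : (g.map C).comp (C X * X) * ((1 + C X * X) ^ a * Ψ) =
      ((g * (1 + X) ^ a).map C).comp (C X * X) * Ψ := by
    rw [← mul_assoc]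
    simp [Polynomial.map_mul, mul_comp]
  rw [hprod, coeff_mul, Finset.sum_eq_single (i, 0)]
  · rw [comp_C_mul_X_coeff, coeff_map, hg i (by simp), if_pos rfl, h0, C_1, one_mul, mul_one]
  · rintro ⟨x, y⟩ hxy hne
    rw [Finset.HasAntidiagonal.mem_antidiagonal] at hxy
    simp only at hxy ⊢
    by_cases hy : A < y
    · rw [coeff_eq_zero_of_natDegree_lt (p := Ψ) (by omega), mul_zero]
    · have hxi : x ≠ i := by
        rintro rfl
        exact hne (by simp; omega)
      rw [comp_C_mul_X_coeff, coeff_map, hg x (Finset.mem_Icc.mpr (by omega)), if_neg hxi,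
        C_0, zero_mul, zero_mul]
  · intro h
    exact absurd (Finset.HasAntidiagonal.mem_antidiagonal.mpr (by simp)) h

theorem X_pow_mem_orbitSpan_of_digit_conditions {p : ℕ} [Fact p.Prime] {n i j : ℕ}
    (hip : i < p) (hjp : j < p) (hi : i ≤ n % p + j)
    (hs : n % p + digitSum p (n / p) ≤ p - 1) (hj : digitSum p (n / p) ≤ j) :
    (X ^ i : (ZMod p)[X]) ∈ orbitSpan p n j := by
  obtain ⟨Ψ, hΨdeg, hΨ0, hΨ⟩ := exists_polynomial_eval_eq_one_add_pow p (n / p)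
  obtain ⟨g, hgdeg, hg⟩ := exists_coeff_mul_one_add_pow_eq_ite (p := p) (a := n % p)
    (D := min (p - 1) (n % p + j)) (by omega) (by omega)
    (Finset.Icc (i - digitSum p (n / p)) i) (fun m hm => by
      rw [Finset.mem_Icc] at hm
      rw [Finset.mem_range]
      omega) (by rw [Nat.card_Icc]; omega) i
  have hΨ'deg : (Ψ.map (expand (ZMod p) p).toRingHom).natDegree ≤ digitSum p (n / p) :=
    natDegree_map_le.trans hΨdeg
  have hΨ'0 : (Ψ.map (expand (ZMod p) p).toRingHom).coeff 0 = 1 := by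
    rw [coeff_map, hΨ0, map_one]
  have hXi := coeff_mul_eq_X_pow hg hΨ'deg hΨ'0
  have hEeval : ∀ c : ZMod p, ((1 + C X * X) ^ (n % p) *
      Ψ.map (expand (ZMod p) p).toRingHom).eval (C c) = (1 + C c * X) ^ n := by
    intro c
    rw [eval_mul, eval_C_map_expand, hΨ, one_add_C_mul_X_pow_eq p c n]
    simp [mul_comm X]
  have hEdeg := (natDegree_mul_le.trans (Nat.add_le_add
    (natDegree_one_add_C_X_mul_X_pow_le (ZMod p) (n % p)) hΨ'deg)).trans_lt
    (by omega : n % p + digitSum p (n / p) < p)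
  have hmem := coeff_mul_X_pow_mem_orbitSpan hjp _ hEdeg hEeval
  rw [← hXi, coeff_mul]
  refine sum_mem fun xy _ => ?_
  rw [comp_C_mul_X_coeff, coeff_map]
  by_cases hx : xy.1 ≤ j
  · rw [mul_assoc, mul_comm (X ^ xy.1), ← smul_eq_C_mul]
    exact Submodule.smul_mem _ _ (hmem _ hx)
  · rw [coeff_eq_zero_of_natDegree_lt (by omega), C_0, zero_mul, zero_mul]
    exact zero_mem _

/-! ### Dehomogenization -/

/-- The substitution `X = 1`, with `Y` renamed `X`. -/
noncomputable def dehomogenize (k : Type*) [CommRing k] : MvPolynomial (Fin 2) k →ₐ[k] k[X] :=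
  MvPolynomial.aeval ![1, X]

/-- Up to swapping the variables, `Polynomial.homogenize` inverts `dehomogenize`. -/
theorem dehomogenize_injOn (k : Type*) [CommRing k] (r : ℕ) :
    Set.InjOn (dehomogenize k) (MvPolynomial.homogeneousSubmodule (Fin 2) k r) := by
  have key : ∀ F : MvPolynomial (Fin 2) k, F.IsHomogeneous r →
      (dehomogenize k F).homogenize r = MvPolynomial.rename (Equiv.swap 0 1) F := by
    intro F hF
    refine homogenize_eq_of_isHomogeneous
      (hF.rename_isHomogeneous (f := Equiv.swap (0 : Fin 2) 1)) ?_
    rw [MvPolynomial.aeval_rename, dehomogenize]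
    congr 2
    ext i
    fin_cases i <;> simp
  intro F hF F' hF' h
  apply MvPolynomial.rename_injective _ (Equiv.swap (0 : Fin 2) 1).injective
  rw [← key F hF, ← key F' hF', h]

theorem monomialVec_mem_monomialSubmodule_iff (p r : ℕ) [Fact p.Prime] (i j : Fin (r + 1)) :
    monomialVec (ZMod p) r i ∈ (monomialSubmodule p r j).toSubmodule ↔
      (X ^ (i : ℕ) : (ZMod p)[X]) ∈ orbitSpan p (r - j) j := by
  set φ := (dehomogenize (ZMod p)).toLinearMap ∘ₗ
    (MvPolynomial.homogeneousSubmodule (Fin 2) (ZMod p) r).subtype with hφ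
  have hφ_inj : Function.Injective φ := fun F F' h =>
    Subtype.ext (dehomogenize_injOn (ZMod p) r F.2 F'.2 h)
  have hvec : ∀ l : Fin (r + 1), φ (monomialVec (ZMod p) r l) = X ^ (l : ℕ) := by
    intro l
    simp [hφ, monomialVec, dehomogenize]
  have horbit : ∀ g : GL (Fin 2) (ZMod p), φ (symPow (ZMod p) r g (monomialVec (ZMod p) r j)) =
      (C (g 0 0) + C (g 1 0) * X) ^ (r - (j : ℕ)) * (C (g 0 1) + C (g 1 1) * X) ^ (j : ℕ) := by
    intro g
    simp [hφ, monomialVec, symPow, subst, dehomogenize, MvPolynomial.algHom_C, algebraMap_eq]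
  have hspan : orbitSpan p (r - j) j = (monomialSubmodule p r j).toSubmodule.map φ := by
    rw [monomialSubmodule, generatedBy, Submodule.map_span, orbitSpan]
    congr 1
    ext F
    simp only [Set.mem_ofPred_eq, Set.mem_image, Set.mem_range, exists_exists_eq_and, horbit]
    constructor
    · rintro ⟨a, b, c, d, hdet, rfl⟩
      refine ⟨Matrix.GeneralLinearGroup.mkOfDetNeZero !![a, b; c, d] ?_, ?_⟩
      · rwa [Matrix.det_fin_two_of]
      · simp [Matrix.GeneralLinearGroup.mkOfDetNeZero]
    · rintro ⟨g, rfl⟩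
      refine ⟨g 0 0, g 0 1, g 1 0, g 1 1, ?_, rfl⟩
      rw [← Matrix.det_fin_two]
      exact g.det_ne_zero
  rw [hspan, ← hvec, Submodule.mem_map]
  exact ⟨fun h => ⟨_, h, rfl⟩, fun ⟨F, hF, h⟩ => hφ_inj h ▸ hF⟩

theorem generatedBy_toSubmodule_le_iff {k G V : Type*} [CommRing k] [Group G] [AddCommGroup V]
    [Module k V] (ρ : Representation k G V) (v : V) (W : Subrepresentation ρ) :
    (generatedBy ρ v).toSubmodule ≤ W.toSubmodule ↔ v ∈ W.toSubmodule := by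
  refine ⟨fun h => h (Submodule.subset_span ⟨1, by simp⟩), fun h => Submodule.span_le.mpr ?_⟩
  rintro _ ⟨g, rfl⟩
  exact W.apply_mem_toSubmodule g h

theorem monomialSubmodule_eq_iff_X_pow_mem {p r : ℕ} [Fact p.Prime] {i j : Fin (r + 1)}
    (hji : j < i) (hip : (i : ℕ) < p) :
    monomialSubmodule p r j = monomialSubmodule p r i ↔
      (X ^ (i : ℕ) : (ZMod p)[X]) ∈ orbitSpan p (r - j) j := by
  have hle : (monomialSubmodule p r j).toSubmodule ≤ (monomialSubmodule p r i).toSubmodule := by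
    rw [monomialSubmodule, generatedBy_toSubmodule_le_iff, monomialVec_mem_monomialSubmodule_iff]
    simpa using pow_mul_X_pow_mem_orbitSpan (n := r - i) hip 0 (b := j) hji.le
  rw [← monomialVec_mem_monomialSubmodule_iff, ← generatedBy_toSubmodule_le_iff]
  exact ⟨fun h => h ▸ le_rfl, fun h => Subrepresentation.ext (le_antisymm hle h)⟩

theorem monomialSubmodule_eq_iff_digit_conditions {p r : ℕ} [Fact p.Prime]
    {i j : Fin (r + 1)} (hji : j < i) (hip : (i : ℕ) < p) :
    monomialSubmodule p r j = monomialSubmodule p r i ↔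
      (i : ℕ) ≤ (r - j) % p + j ∧ (r - j) % p + digitSum p ((r - j) / p) ≤ p - 1 ∧
        digitSum p ((r - j) / p) ≤ j := by
  have hji' : (j : ℕ) < i := hji
  rw [monomialSubmodule_eq_iff_X_pow_mem hji hip]
  refine ⟨fun h => ?_, fun ⟨h₁, h₂, h₃⟩ =>
    X_pow_mem_orbitSpan_of_digit_conditions hip (by omega) h₁ h₂ h₃⟩
  -- If `r - j ≤ i`, then `r - j` has a single digit and the conditions hold trivially.
  by_cases hin : (i : ℕ) < r - j
  · exact digit_conditions_of_X_pow_mem_orbitSpan hji' hip hin h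
  · rw [Nat.mod_eq_of_lt (by omega : r - j < p), Nat.div_eq_of_lt (by omega : r - j < p),
      digitSum_zero]
    omega

/-! ### Digits and carries of `r - j` -/

theorem mod_sub_and_div_sub_of_le {p r j : ℕ} (hp : 0 < p) (h : j ≤ r % p) :
    (r - j) % p = r % p - j ∧ (r - j) / p = r / p := by
  have hr := Nat.div_add_mod r p
  have hlt := Nat.mod_lt r hp
  rw [show r - j = (r % p - j) + p * (r / p) by omega, Nat.add_mul_mod_self_left,
    Nat.add_mul_div_left _ _ hp, Nat.mod_eq_of_lt (by omega : r % p - j < p),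
    Nat.div_eq_of_lt (by omega : r % p - j < p), zero_add]
  exact ⟨rfl, rfl⟩

theorem mod_sub_and_div_sub_of_lt {p r j : ℕ} (hr : p ≤ r) (hjp : j < p) (h : r % p < j) :
    (r - j) % p = r % p + p - j ∧ (r - j) / p + 1 = r / p := by
  have hr' := Nat.div_add_mod r p
  have hpos : 0 < r / p := Nat.div_pos hr (by omega)
  obtain ⟨q, hq⟩ := Nat.exists_eq_add_of_lt hpos
  rw [zero_add] at hq
  rw [hq, mul_add] at hr'
  rw [hq, show r - j = (r % p + p - j) + p * q by omega, Nat.add_mul_mod_self_left,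
    Nat.add_mul_div_left _ _ (by omega), Nat.mod_eq_of_lt (by omega : r % p + p - j < p),
    Nat.div_eq_of_lt (by omega : r % p + p - j < p), zero_add]
  exact ⟨rfl, rfl⟩

theorem digit_conditions_iff {p r i j : ℕ} (hr : p ≤ r) (hji : j < i) (hip : i < p) :
    (i ≤ (r - j) % p + j ∧ (r - j) % p + digitSum p ((r - j) / p) ≤ p - 1 ∧
        digitSum p ((r - j) / p) ≤ j) ↔
      r % p ∉ Finset.Ico j i ∧ digitSum p (r - j) ≤ p - 1 ∧ digitSum p (r - r % p) ≤ j := by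
  have hp : 1 < p := by omega
  have hlt := Nat.mod_lt r (show p > 0 by omega)
  have h0 : digitSum p (r - r % p) = digitSum p (r / p) := by
    rw [show r - r % p = p * (r / p) + 0 by have := Nat.div_add_mod r p; omega,
      digitSum_mul_add hp _ (by omega), zero_add]
  rw [h0, digitSum_eq_mod_add_digitSum_div hp (r - j), Finset.mem_Ico]
  by_cases h : j ≤ r % p
  · obtain ⟨h₁, h₂⟩ := mod_sub_and_div_sub_of_le (by omega) h
    rw [h₁, h₂]
    omega
  · obtain ⟨h₁, h₂⟩ := mod_sub_and_div_sub_of_lt hr (by omega) (not_le.mp h)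
    have h₃ := digitSum_succ_le hp ((r - j) / p)
    rw [h₂] at h₃
    rw [h₁]
    omega

theorem carryPattern_one {p r : ℕ} (i : Fin (r + 1)) (hip : (i : ℕ) < p) (hr : p ≤ r) :
    carryPattern p r i 1 = if r % p < i then 1 else 0 := by
  simp only [carryPattern, carry, pow_zero, Nat.div_one, Nat.mod_eq_of_lt hip, add_zero]
  by_cases h : (i : ℕ) ≤ r % p
  · rw [(mod_sub_and_div_sub_of_le (by omega) h).1]
    have := Nat.mod_lt r (show p > 0 by omega)
    rw [if_neg (by omega), if_neg (by omega)]
  · rw [(mod_sub_and_div_sub_of_lt hr hip (by omega)).1, if_pos (by omega), if_pos (by omega)]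

theorem carryPattern_eq_iff {p r : ℕ} (hr : p ≤ r) {i j : Fin (r + 1)} (hji : j < i)
    (hip : (i : ℕ) < p) :
    carryPattern p r i = carryPattern p r j ↔ r % p ∉ Finset.Ico (j : ℕ) (i : ℕ) := by
  have hji' : (j : ℕ) < i := hji
  have hi1 := carryPattern_one i hip hr
  have hj1 := carryPattern_one j (by omega) hr
  rw [Finset.mem_Ico]
  constructor
  · rintro h ⟨h₁, h₂⟩
    rw [h, hj1, if_neg (by omega), if_pos h₂] at hi1
    exact zero_ne_one hi1
  · intro h
    -- The numbers `r - i` and `r - j` have the same digits above the constant one.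
    have hdiv : (r - i) / p = (r - j) / p := by
      by_cases hi : (i : ℕ) ≤ r % p
      · rw [(mod_sub_and_div_sub_of_le (by omega) hi).2,
          (mod_sub_and_div_sub_of_le (by omega) (by omega : (j : ℕ) ≤ r % p)).2]
      · have h₁ := (mod_sub_and_div_sub_of_lt hr hip (by omega)).2
        have h₂ := (mod_sub_and_div_sub_of_lt hr (by omega : (j : ℕ) < p) (by omega)).2
        omega
    have hone : carryPattern p r i 1 = carryPattern p r j 1 := by
      rw [hi1, hj1]
      split_ifs <;> omega
    funext t
    induction t with
    | zero => rfl
    | succ t ih =>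
      rcases Nat.eq_zero_or_pos t with rfl | ht
      · exact hone
      · have hstep : ∀ a b, carry p a b (t + 1) =
            if p ≤ a / p ^ t % p + b / p ^ t % p + carry p a b t then 1 else 0 := fun _ _ => rfl
        have hsmall : ∀ x, x < p → x / p ^ t = 0 := fun x hx =>
          Nat.div_eq_of_lt (hx.trans_le (Nat.le_self_pow ht.ne' p))
        have hdiv_pow : (r - i) / p ^ t = (r - j) / p ^ t := by
          rw [← Nat.sub_add_cancel ht, pow_succ', ← Nat.div_div_eq_div_mul, hdiv,
            Nat.div_div_eq_div_mul]
        simp only [carryPattern] at ih ⊢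
        rw [hstep, hstep, ih, hdiv_pow, hsmall i hip, hsmall j (by omega)]

end MonomialLattice

theorem mainTheorem1 (p : ℕ) [Fact p.Prime] (r : ℕ) (hr : p ≤ r) (i j : Fin (r + 1))
    (hji : j < i) (hip : (i : ℕ) ≤ p - 1) :
    (MonomialLattice.monomialSubmodule p r j = MonomialLattice.monomialSubmodule p r i ↔
      r % p ∉ Finset.Ico (j : ℕ) (i : ℕ) ∧
      MonomialLattice.digitSum p (r - (j : ℕ)) ≤ p - 1 ∧
      MonomialLattice.digitSum p (r - r % p) ≤ (j : ℕ)) ∧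
    (MonomialLattice.monomialSubmodule p r j = MonomialLattice.monomialSubmodule p r i ↔
      MonomialLattice.carryPattern p r i = MonomialLattice.carryPattern p r j ∧
      MonomialLattice.digitSum p (r - (j : ℕ)) ≤ p - 1 ∧
      MonomialLattice.digitSum p (r - r % p) ≤ (j : ℕ)) := by
  have hp := (Fact.out : p.Prime).pos
  have hip' : (i : ℕ) < p := by omega
  rw [MonomialLattice.carryPattern_eq_iff hr hji hip', and_self,
    MonomialLattice.monomialSubmodule_eq_iff_digit_conditions hji hip',
    MonomialLattice.digit_conditions_iff hr hji hip']
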